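/- Let $X$ be a complete metric space with metric $d$ and let $p \ge 1$ be a real number. Let $P_p(X)$ be the set of Radon probability measures on $X$ (Borel probability measures $\mu$ with $\mu(B) = \sup\{\mu(C) \mid C \subseteq B,\ C \text{ compact}\}$ for every Borel set $B$) with finite moment of order $p$, i.e. $\int d(x_0,x)^p\,\mathrm{d}\mu(x) < \infty$ for some (equivalently, every) $x_0 \in X$. For $\mu,\nu \in P_p(X)$ let $$W_p(\mu,\nu) = \Big(\inf_\gamma \int d(x,y)^p\,\mathrm{d}\gamma(x,y)\Big)^{1/p},$$ where $\gamma$ runs over the couplings of $\mu$ and $\nu$, i.e. the Borel probability measures on $X \times X$ with first marginal $\mu$ and second marginal $\nu$. Then $W_p$ is a (finite-valued) metric on $P_p(X)$ and it metrises $p$-weak convergence: for every $x_0 \in X$, every sequence $(\mu_i)_{i \ge 0}$ in $P_p(X)$ and every $\mu \in P_p(X)$, one has $\mu_i \to \mu$ with respect to $W_p$ if and only if $\mu_i$ converges $p$-weakly to $\mu$, that is, $\int f\,\mathrm{d}\mu_i \to \int f\,\mathrm{d}\mu$ for every bounded continuous $f : X \to \mathbb{R}$ and $\int d(x_0,x)^p\,\mathrm{d}\mu_i(x)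 \to \int d(x_0,x)^p\,\mathrm{d}\mu(x)$. -/

import Mathlib

open MeasureTheory Filter Topology
open scoped ENNReal

namespace Wasserstein

variable {X : Type*} [MetricSpace X] [MeasurableSpace X] [BorelSpace X]

/-- The moment of order `p` about `x₀`: the integral of `d(x₀, -) ^ p`. The integrand is Borel, so
this is the usual integral, with values in `[0, ∞]`. -/
noncomputable def moment (p : ℝ) (x₀ : X) (μ : Measure X) : ℝ≥0∞ :=
  ∫⁻ x, edist x₀ x ^ p ∂μ

/-- A coupling of `μ` and `ν`: a Borel probability measure on the topological space `X × X` with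
marginals `μ` and `ν`. As `X` need not be separable, the Borel σ-algebra of `X × X` may be strictly
finer than the product σ-algebra, so it is named explicitly. -/
structure IsCoupling (γ : @Measure (X × X) (borel (X × X))) (μ ν : Measure X) : Prop where
  isProbabilityMeasure : @IsProbabilityMeasure (X × X) (borel (X × X)) γ
  map_fst : @Measure.map (X × X) X (borel (X × X)) _ Prod.fst γ = μ
  map_snd : @Measure.map (X × X) X (borel (X × X)) _ Prod.snd γ = ν

/-- The integral of `d ^ p` with respect to a Borel measure on `X × X`. -/
noncomputable def cost (p : ℝ) (γ : @Measure (X × X) (borel (X × X))) : ℝ≥0∞ :=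
  @lintegral (X × X) (borel (X × X)) γ (fun z => edist z.1 z.2 ^ p)

/-- The Wasserstein distance of order `p`: the `p`-th root of the infimum of the integrals of
`d ^ p` over all couplings. -/
noncomputable def wassersteinDist (p : ℝ) (μ ν : Measure X) : ℝ≥0∞ :=
  (⨅ (γ : @Measure (X × X) (borel (X × X))) (_ : IsCoupling γ μ ν), cost p γ) ^ (1 / p)

/-- `P_p(X)`: the Radon probability measures on `X` with finite moment of order `p`. Mathlib's
`Measure.InnerRegular` says that the measure of each Borel set is the supremum of the measures of
its compact subsets. -/
@[ext]
structure PSpace (p : ℝ) (X : Type*) [MetricSpace X] [MeasurableSpace X] [BorelSpace X] where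
  toProb : ProbabilityMeasure X
  radon : (toProb : Measure X).InnerRegular
  finite_moment : ∃ x₀ : X, moment p x₀ (toProb : Measure X) < ∞

/-- `p`-weak convergence of a sequence in `P_p(X)`, with base point `x₀`: weak convergence (the
topology of `ProbabilityMeasure X` is that of convergence of integrals of bounded continuous
functions) together with convergence of the moments of order `p` about `x₀`. -/
def PWeakTendsto {p : ℝ} (x₀ : X) (μs : ℕ → PSpace p X) (μ : PSpace p X) : Prop :=
  Tendsto (fun i => (μs i).toProb) atTop (𝓝 μ.toProb) ∧
    Tendsto (fun i => moment p x₀ ((μs i).toProb : Measure X)) atTop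
      (𝓝 (moment p x₀ (μ.toProb : Measure X)))

end Wasserstein

namespace Wasserstein

/-! ### Couplings, symmetry, and the passage from `W_p` to weak convergence and moments -/

section Coupling

variable {X : Type*} [MetricSpace X] [MeasurableSpace X] [BorelSpace X]

/-! Radon measures remove the lack of separability: countably many of them live on one closed
separable set `T` (`exists_isClosed_isSeparable`), Polish when `X` is complete, and their couplings
come from `T × T`. Disintegration there glues couplings (`exists_gluing`), and Minkowski's
inequality yields the triangle inequality.

Markov's inequality bounds the Lévy–Prokhorov distance in terms of `W_p`, so `W_p` convergence
implies weak convergence and `W_p` separates points. The `p`-th root of the moment is 1-Lipschitz,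
so moments converge too.

For the converse, a partition of unity of small support covers most of the mass of the limit. On
each piece the mass common to both measures is moved a short way; the unmatched remainders are
coupled arbitrarily (`exists_coupling_cost_le`). Weak convergence makes their mass small, and the
cost of moving them is at most a constant times this mass plus tails of `d ^ p`, which convergence
of moments controls uniformly. -/

theorem measurable_of_continuous_borel {Y : Type*} [TopologicalSpace Y] [MeasurableSpace Y]
    [BorelSpace Y] {Z : Type*} [TopologicalSpace Z] {f : Z → Y} (hf : Continuous f) :
    @Measurable Z Y (borel Z) _ f :=
  @Continuous.measurable Z Y _ (borel Z)
    (@BorelSpace.opensMeasurable _ _ (borel Z) (@BorelSpace.mk _ _ (borel Z) rfl)) _ _ _ _ hf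

/-- The law of a measurable map `h` into `X × X` with its Borel σ-algebra has marginals the laws of
the components. -/
theorem map_pair {Ω : Type*} [MeasurableSpace Ω] {P : Measure Ω} {h : Ω → X × X}
    (hh : @Measurable Ω (X × X) _ (borel (X × X)) h) :
    @Measure.map (X × X) X (borel (X × X)) _ Prod.fst
        (@Measure.map Ω (X × X) _ (borel (X × X)) h P) = P.map (fun ω => (h ω).1) ∧
      @Measure.map (X × X) X (borel (X × X)) _ Prod.snd
        (@Measure.map Ω (X × X) _ (borel (X × X)) h P) = P.map (fun ω => (h ω).2) :=
  ⟨@Measure.map_map Ω (X × X) X _ (borel (X × X)) _ _ _ _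
      (measurable_of_continuous_borel continuous_fst) hh,
    @Measure.map_map Ω (X × X) X _ (borel (X × X)) _ _ _ _
      (measurable_of_continuous_borel continuous_snd) hh⟩

omit [MeasurableSpace X] [BorelSpace X] in
theorem measurable_cost_integrand (p : ℝ) :
    @Measurable (X × X) ℝ≥0∞ (borel (X × X)) _ (fun z => edist z.1 z.2 ^ p) :=
  (measurable_of_continuous_borel (continuous_fst.edist continuous_snd)).pow_const p

theorem isCoupling_map {Ω : Type*} [MeasurableSpace Ω] {P : Measure Ω} [IsProbabilityMeasure P]
    {h : Ω → X × X} (hh : @Measurable Ω (X × X) _ (borel (X × X)) h) :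
    IsCoupling (@Measure.map Ω (X × X) _ (borel (X × X)) h P)
      (P.map fun ω => (h ω).1) (P.map fun ω => (h ω).2) where
  isProbabilityMeasure :=
    @IsProbabilityMeasure.mk _ (borel (X × X)) _ <| by
      rw [@Measure.map_apply _ _ _ (borel (X × X)) _ _ hh _ (@MeasurableSet.univ _ (borel _))]
      simp
  map_fst := (map_pair hh).1
  map_snd := (map_pair hh).2

omit [MeasurableSpace X] [BorelSpace X] in
theorem cost_map {Ω : Type*} [MeasurableSpace Ω] {P : Measure Ω} {h : Ω → X × X} (p : ℝ)
    (hh : @Measurable Ω (X × X) _ (borel (X × X)) h) :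
    cost p (@Measure.map Ω (X × X) _ (borel (X × X)) h P) =
      ∫⁻ ω, edist (h ω).1 (h ω).2 ^ p ∂P :=
  @lintegral_map Ω (X × X) _ (borel (X × X)) _ _ _ (measurable_cost_integrand p) hh

/-- A coupling is the joint law of two random variables. -/
theorem IsCoupling.exists_randomVariables {X : Type*} [MetricSpace X] [MeasurableSpace X]
    [BorelSpace X] {γ : @Measure (X × X) (borel (X × X))} {μ ν : Measure X}
    (h : IsCoupling γ μ ν) (p : ℝ) :
    ∃ (m : MeasurableSpace (X × X)) (P : @Measure (X × X) m) (f g : X × X → X),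
      @IsProbabilityMeasure _ m P ∧ @Measurable _ _ m _ f ∧ @Measurable _ _ m _ g ∧
      @Measurable _ _ m _ (fun ω => edist (f ω) (g ω)) ∧
      @Measurable _ _ m (borel (X × X)) (fun ω => (g ω, f ω)) ∧
      @Measure.map _ _ m _ f P = μ ∧ @Measure.map _ _ m _ g P = ν ∧
      cost p γ = @lintegral _ m P (fun ω => edist (f ω) (g ω) ^ p) :=
  ⟨borel (X × X), γ, Prod.fst, Prod.snd, h.isProbabilityMeasure,
    measurable_of_continuous_borel continuous_fst, measurable_of_continuous_borel continuous_snd,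
    measurable_of_continuous_borel (continuous_fst.edist continuous_snd),
    @Continuous.measurable _ _ _ (borel _) (@BorelSpace.opensMeasurable _ _ (borel _)
      (@BorelSpace.mk _ _ (borel _) rfl)) _ (borel _) (@BorelSpace.mk _ _ (borel _) rfl) _
      continuous_swap, h.map_fst, h.map_snd, rfl⟩

omit [BorelSpace X] in
theorem wassersteinDist_le {p : ℝ} (hp : 0 ≤ p) {μ ν : Measure X}
    {γ : @Measure (X × X) (borel (X × X))} (hγ : IsCoupling γ μ ν) :
    wassersteinDist p μ ν ≤ cost p γ ^ (1 / p) :=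
  ENNReal.rpow_le_rpow (iInf₂_le γ hγ) (by positivity)

omit [BorelSpace X] in
theorem exists_coupling_lt {p : ℝ} (hp : 0 < p) {μ ν : Measure X} {c : ℝ≥0∞}
    (h : wassersteinDist p μ ν < c) :
    ∃ γ, IsCoupling γ μ ν ∧ cost p γ ^ (1 / p) < c := by
  have h' : (⨅ (γ : @Measure (X × X) (borel (X × X))) (_ : IsCoupling γ μ ν), cost p γ)
      < c ^ p := by
    rw [← ENNReal.rpow_inv_lt_iff hp]
    simpa [wassersteinDist] using h
  obtain ⟨γ, hγ, hc⟩ := by simpa only [iInf_lt_iff] using h'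
  refine ⟨γ, hγ, ?_⟩
  rw [one_div, ENNReal.rpow_inv_lt_iff hp]
  exact hc

theorem wassersteinDist_self {p : ℝ} (hp : 0 < p) (μ : Measure X) [IsProbabilityMeasure μ] :
    wassersteinDist p μ μ = 0 := by
  have hd : @Measurable X (X × X) _ (borel (X × X)) (fun x => (x, x)) :=
    @Continuous.measurable _ _ _ _ _ _ (borel _) (@BorelSpace.mk _ _ (borel _) rfl) _
      (by fun_prop)
  have h := isCoupling_map (P := μ) hd
  simp only [Measure.map_id'] at h
  have := wassersteinDist_le hp.le h
  rw [cost_map p hd] at this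
  simpa [hp] using this

theorem wassersteinDist_comm_le {p : ℝ} (hp : 0 < p) (μ ν : Measure X) :
    wassersteinDist p ν μ ≤ wassersteinDist p μ ν := by
  refine le_of_forall_gt fun c hc => ?_
  obtain ⟨γ, hγ, hlt⟩ := exists_coupling_lt hp hc
  obtain ⟨m, P, f, g, hP, hf, hg, -, hgf, rfl, rfl, hcost⟩ := hγ.exists_randomVariables p
  refine (wassersteinDist_le hp.le (isCoupling_map (P := P) hgf)).trans_lt ?_
  rw [cost_map p hgf]
  simp_rw [edist_comm (g _)]
  rwa [← hcost]

theorem wassersteinDist_comm {p : ℝ} (hp : 0 < p) (μ ν : Measure X) :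
    wassersteinDist p μ ν = wassersteinDist p ν μ :=
  le_antisymm (wassersteinDist_comm_le hp _ _) (wassersteinDist_comm_le hp _ _)

theorem measurable_edist_rpow (p : ℝ) (x₀ : X) : Measurable fun x => edist x₀ x ^ p :=
  (measurable_edist_right).pow_const p

/-- The `p`-th root of the moment is 1-Lipschitz for the Wasserstein distance. -/
theorem moment_rpow_le {p : ℝ} (hp : 1 ≤ p) (x₀ : X) (μ ν : Measure X) :
    moment p x₀ μ ^ (1 / p) ≤ moment p x₀ ν ^ (1 / p) + wassersteinDist p μ ν := by
  have hp0 : 0 < p := by linarith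
  rcases eq_or_ne (wassersteinDist p μ ν) ∞ with h | h
  · simp [h]
  refine ENNReal.le_of_forall_pos_le_add fun ε hε _ => ?_
  obtain ⟨γ, hγ, hlt⟩ := exists_coupling_lt hp0
    (ENNReal.lt_add_right h (ENNReal.coe_pos.2 hε).ne')
  rw [add_assoc]
  refine le_trans ?_ (add_le_add_right hlt.le _)
  obtain ⟨m, P, f, g, hP, hf, hg, hfg, -, rfl, rfl, hcost⟩ := hγ.exists_randomVariables p
  rw [hcost, moment, moment, lintegral_map (measurable_edist_rpow p x₀) hf,
    lintegral_map (measurable_edist_rpow p x₀) hg]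
  have hg' : Measurable fun ω => edist x₀ (g ω) := measurable_edist_right.comp hg
  refine le_trans ?_ (ENNReal.lintegral_Lp_add_le hg'.aemeasurable hfg.aemeasurable hp)
  refine ENNReal.rpow_le_rpow (lintegral_mono fun ω => ?_) (by positivity)
  refine ENNReal.rpow_le_rpow ?_ hp0.le
  simp only [Pi.add_apply]
  rw [edist_comm (f ω)]
  exact edist_triangle _ _ _

/-- Markov's inequality for the displacement of a coupling. -/
theorem measure_le_thickening_add {p : ℝ} (hp : 0 < p) {μ ν : Measure X}
    {γ : @Measure (X × X) (borel (X × X))} (hγ : IsCoupling γ μ ν) {δ : ℝ≥0∞} (h0 : δ ≠ 0)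
    (ht : δ ≠ ∞) (hc : cost p γ ≤ δ ^ p * δ) {B : Set X} (hB : MeasurableSet B) :
    μ B ≤ ν (Metric.thickening δ.toReal B) + δ := by
  obtain ⟨m, P, f, g, hP, hf, hg, hfg, -, rfl, rfl, hcost⟩ := hγ.exists_randomVariables p
  rw [Measure.map_apply hf hB, Measure.map_apply hg Metric.isOpen_thickening.measurableSet]
  -- Either the displacement is below `δ`, so that `g ω` lies in the thickening, or `ω` lies in the
  -- Markov set, of measure at most `cost / δ ^ p ≤ δ`.
  have h1 : f ⁻¹' B ⊆ g ⁻¹' (Metric.thickening δ.toReal B) ∪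
      {ω | δ ^ p ≤ edist (f ω) (g ω) ^ p} := by
    intro ω hω
    rcases lt_or_ge (edist (f ω) (g ω)) δ with h | h
    · refine Or.inl (Metric.mem_thickening_iff_infEDist_lt.2 ?_)
      rw [ENNReal.ofReal_toReal ht]
      exact (Metric.infEDist_le_edist_of_mem (x := g ω) hω).trans_lt (by rwa [edist_comm])
    · exact Or.inr (ENNReal.rpow_le_rpow h hp.le)
  refine (measure_mono h1).trans ((measure_union_le _ _).trans (add_le_add_right ?_ _))
  have hδ : δ ^ p ≠ 0 := by simp [h0, ht]
  have hδ' : δ ^ p ≠ ∞ := by simp [h0, ht]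
  refine (ENNReal.mul_le_mul_iff_right hδ hδ').1 ?_
  rw [hcost] at hc
  exact (mul_meas_ge_le_lintegral (hfg.pow_const p) _).trans hc

/-- The threshold `δ ^ p * δ` lets one `δ` serve both as thickening radius and as additive error in
Markov's inequality. -/
theorem levyProkhorovEDist_le {p : ℝ} (hp : 0 < p) {μ ν : Measure X} {δ : ℝ≥0∞}
    (h0 : δ ≠ 0) (ht : δ ≠ ∞) (h : wassersteinDist p μ ν < (δ ^ p * δ) ^ (1 / p)) :
    levyProkhorovEDist μ ν ≤ δ := by
  have key : ∀ {μ ν : Measure X}, wassersteinDist p μ ν < (δ ^ p * δ) ^ (1 / p) →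
      ∀ {B : Set X}, MeasurableSet B → μ B ≤ ν (Metric.thickening δ.toReal B) + δ := by
    intro μ ν h B hB
    obtain ⟨γ, hγ, hlt⟩ := exists_coupling_lt hp h
    refine measure_le_thickening_add hp hγ h0 ht ?_ hB
    exact ((ENNReal.rpow_lt_rpow_iff (by positivity)).1 hlt).le
  exact sInf_le fun B hB => ⟨key h hB, key (by rwa [wassersteinDist_comm hp]) hB⟩

/-- Convergence in the Wasserstein distance implies weak convergence. -/
theorem tendsto_of_wassersteinDist {p : ℝ} (hp : 0 < p) {ι : Type*} {l : Filter ι}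
    {μs : ι → ProbabilityMeasure X} {μ : ProbabilityMeasure X}
    (h : Tendsto (fun i => wassersteinDist p (μs i : Measure X) (μ : Measure X)) l (𝓝 0)) :
    Tendsto μs l (𝓝 μ) := by
  have h' : Tendsto (fun i => LevyProkhorov.ofMeasure (μs i)) l (𝓝 (LevyProkhorov.ofMeasure μ)) := by
    rw [EMetric.tendsto_nhds]
    intro ε hε
    -- The minimum with 1 keeps `δ` finite when `ε = ∞`.
    obtain ⟨δ, hδ0, hδ⟩ := exists_between (lt_min hε one_pos)
    have hδt : δ ≠ ∞ := (hδ.trans_le (min_le_right _ _)).ne_top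
    have hpos : 0 < (δ ^ p * δ) ^ (1 / p) := by
      have : δ ^ p * δ ≠ 0 := mul_ne_zero (by simp [hδ0.ne', hδt]) hδ0.ne'
      have h2 : δ ^ p * δ ≠ ∞ := ENNReal.mul_ne_top (by simp [hδ0.ne', hδt]) hδt
      exact ENNReal.rpow_pos this.bot_lt h2
    filter_upwards [h.eventually_lt_const hpos] with i hi
    rw [LevyProkhorov.edist_probabilityMeasure_def]
    exact (levyProkhorovEDist_le hp hδ0.ne' hδt hi).trans_lt (hδ.trans_le (min_le_left _ _))
  exact (LevyProkhorov.continuous_toMeasure_probabilityMeasure.tendsto _).comp h'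

/-- The Lipschitz bound `moment_rpow_le`, used in both directions, squeezes the roots. An infinite
moment is allowed, as the subtrahend tends to `0 ≠ ∞`. -/
theorem tendsto_moment {p : ℝ} (hp : 1 ≤ p) (x₀ : X) {ι : Type*} {l : Filter ι}
    {μs : ι → Measure X} {μ : Measure X}
    (h : Tendsto (fun i => wassersteinDist p (μs i) μ) l (𝓝 0)) :
    Tendsto (fun i => moment p x₀ (μs i)) l (𝓝 (moment p x₀ μ)) := by
  have hp0 : 0 < p := by linarith
  have h1 : Tendsto (fun i => moment p x₀ (μs i) ^ (1 / p)) l (𝓝 (moment p x₀ μ ^ (1 / p))) := by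
    refine tendsto_of_tendsto_of_tendsto_of_le_of_le
      (g := fun i => moment p x₀ μ ^ (1 / p) - wassersteinDist p (μs i) μ)
      (h := fun i => moment p x₀ μ ^ (1 / p) + wassersteinDist p (μs i) μ) ?_ ?_ ?_ ?_
    · simpa using ENNReal.Tendsto.sub (tendsto_const_nhds (x := moment p x₀ μ ^ (1 / p))) h
        (Or.inr ENNReal.zero_ne_top)
    · simpa using (tendsto_const_nhds (x := moment p x₀ μ ^ (1 / p))).add h
    · intro i
      refine tsub_le_iff_right.2 ?_
      rw [wassersteinDist_comm hp0]
      exact moment_rpow_le hp x₀ _ _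
    · intro i
      exact moment_rpow_le hp x₀ _ _
  have h2 := ((ENNReal.continuous_rpow_const (y := p)).tendsto _).comp h1
  simpa [Function.comp_def, ← ENNReal.rpow_mul, hp0.ne'] using h2

/-- The constant sequence `μ` then converges weakly to `ν`, and the weak topology is Hausdorff. -/
theorem eq_of_wassersteinDist_eq_zero {p : ℝ} (hp : 0 < p) {μ ν : ProbabilityMeasure X}
    (h : wassersteinDist p (μ : Measure X) (ν : Measure X) = 0) : μ = ν := by
  have : Tendsto (fun _ : ℕ => μ) atTop (𝓝 ν) := by
    apply tendsto_of_wassersteinDist hp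
    simp only [h]
    exact tendsto_const_nhds
  exact tendsto_nhds_unique tendsto_const_nhds this

end Coupling

/-! ### Reduction to a closed separable subset -/

section Separable

variable {X : Type*} [MetricSpace X] [MeasurableSpace X] [BorelSpace X]

/-- A finite inner regular measure is concentrated on a separable set. -/
theorem exists_isSeparable_measure_compl_eq_zero (μ : Measure X) [IsProbabilityMeasure μ]
    (h : μ.InnerRegular) : ∃ S : Set X, TopologicalSpace.IsSeparable S ∧ μ Sᶜ = 0 := by
  have key : ∀ n : ℕ, ∃ K : Set X, IsCompact K ∧ μ Kᶜ ≤ (n + 1 : ℝ≥0∞)⁻¹ := by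
    intro n
    have hn : (n + 1 : ℝ≥0∞)⁻¹ ≠ 0 := by simp
    have : 1 - (n + 1 : ℝ≥0∞)⁻¹ < μ Set.univ := by
      rw [measure_univ]
      exact ENNReal.sub_lt_self ENNReal.one_ne_top one_ne_zero hn
    obtain ⟨K, -, hK, hlt⟩ := MeasurableSet.univ.exists_lt_isCompact this
    refine ⟨K, hK, ?_⟩
    rw [prob_compl_eq_one_sub hK.measurableSet]
    exact tsub_le_iff_tsub_le.1 hlt.le
  choose K hK hle using key
  refine ⟨⋃ n, K n, TopologicalSpace.isSeparable_iUnion.2 fun n => (hK n).isSeparable, ?_⟩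
  have ht : Tendsto (fun n : ℕ => (n + 1 : ℝ≥0∞)⁻¹) atTop (𝓝 0) := by
    simpa using (tendsto_add_atTop_iff_nat 1).2 ENNReal.tendsto_inv_nat_nhds_zero
  refine le_antisymm (ge_of_tendsto' ht fun n => ?_) zero_le
  exact (measure_mono (Set.compl_subset_compl.2 (Set.subset_iUnion K n))).trans (hle n)

/-- Countably many Radon probability measures are concentrated on a common closed separable set. -/
theorem exists_isClosed_isSeparable {ι : Type*} [Countable ι] (μ : ι → Measure X)
    [∀ i, IsProbabilityMeasure (μ i)] (h : ∀ i, (μ i).InnerRegular) :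
    ∃ T : Set X, IsClosed T ∧ TopologicalSpace.IsSeparable T ∧ ∀ i, μ i Tᶜ = 0 := by
  choose S hS h0 using fun i => exists_isSeparable_measure_compl_eq_zero (μ i) (h i)
  refine ⟨closure (⋃ i, S i), isClosed_closure,
    (TopologicalSpace.isSeparable_iUnion.2 hS).closure, fun i => measure_mono_null ?_ (h0 i)⟩
  exact Set.compl_subset_compl.2 ((Set.subset_iUnion S i).trans subset_closure)

omit [MeasurableSpace X] [BorelSpace X] in
theorem secondCountableTopology_of_isSeparable {T : Set X} (hT : TopologicalSpace.IsSeparable T) :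
    SecondCountableTopology T :=
  have := hT.separableSpace
  UniformSpace.secondCountable_of_separable T

/-- Separability enters here: second countability makes the product σ-algebra of `T × T` its Borel
σ-algebra. -/
theorem measurable_prodMap_coe (T : Set X) [SecondCountableTopology T] :
    @Measurable (T × T) (X × X) _ (borel (X × X)) (fun z => ((z.1 : X), (z.2 : X))) :=
  @Continuous.measurable _ _ _ _ _ _ (borel _) (@BorelSpace.mk _ _ (borel _) rfl) _
    (by fun_prop)

/-- Finite measures of equal mass that are concentrated on a separable set have a transport plan. -/
theorem exists_measure_map_fst_snd {T : Set X} (hTm : MeasurableSet T)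
    (hT : TopologicalSpace.IsSeparable T)
    (α β : Measure X) [IsFiniteMeasure α] [IsFiniteMeasure β]
    (hα : α Tᶜ = 0) (hβ : β Tᶜ = 0) (hαβ : α Set.univ = β Set.univ) :
    ∃ γ : @Measure (X × X) (borel (X × X)),
      @Measure.map (X × X) X (borel (X × X)) _ Prod.fst γ = α ∧
      @Measure.map (X × X) X (borel (X × X)) _ Prod.snd γ = β := by
  have := secondCountableTopology_of_isSeparable hT
  have hmap : ∀ α : Measure X, α Tᶜ = 0 → (α.comap ((↑) : T → X)).map (↑) = α := by
    intro α hα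
    rw [map_comap_subtype_coe hTm, Measure.restrict_eq_self_of_ae_mem]
    exact hα
  have huniv : ∀ α : Measure X, α Tᶜ = 0 → α.comap ((↑) : T → X) Set.univ = α Set.univ := by
    intro α hα
    conv_rhs => rw [← hmap α hα, Measure.map_apply measurable_subtype_coe .univ]
    rfl
  have hfin : ∀ α : Measure X, [IsFiniteMeasure α] → α Tᶜ = 0 →
      IsFiniteMeasure (α.comap ((↑) : T → X)) := by
    intro α _ hα
    exact ⟨by rw [huniv α hα]; exact measure_lt_top _ _⟩
  have := hfin α hα
  have := hfin β hβ
  -- Mass zero is set apart because the plan below is the product measure divided by the mass.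
  rcases eq_or_ne (α Set.univ) 0 with h0 | h0
  · refine ⟨0, ?_, ?_⟩
    · rw [Measure.measure_univ_eq_zero.1 h0, Measure.map_zero]
    · rw [hαβ] at h0
      rw [Measure.measure_univ_eq_zero.1 h0, Measure.map_zero]
  have hm := map_pair (P := (α Set.univ)⁻¹ •
    (α.comap ((↑) : T → X)).prod (β.comap ((↑) : T → X))) (measurable_prodMap_coe T)
  refine ⟨_, hm.1.trans ?_, hm.2.trans ?_⟩
  · have hc : (fun z : T × T => (z.1 : X)) = ((↑) : T → X) ∘ Prod.fst := rfl
    rw [Measure.map_smul, hc, ← Measure.map_map measurable_subtype_coe measurable_fst,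
      Measure.map_fst_prod, Measure.map_smul, hmap α hα,
      huniv β hβ, ← hαβ, smul_smul, ENNReal.inv_mul_cancel h0 (measure_ne_top _ _), one_smul]
  · have hc : (fun z : T × T => (z.2 : X)) = ((↑) : T → X) ∘ Prod.snd := rfl
    rw [Measure.map_smul, hc, ← Measure.map_map measurable_subtype_coe measurable_snd,
      Measure.map_snd_prod, Measure.map_smul, hmap β hβ,
      huniv α hα, smul_smul, ENNReal.inv_mul_cancel h0 (measure_ne_top _ _), one_smul]

/-- A coupling of measures concentrated on a closed separable set `T` comes from `T × T`. -/
theorem IsCoupling.exists_measure_subtype {T : Set X} (hTc : IsClosed T)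
    [SecondCountableTopology T] {μ ν : Measure X} (hμ : μ Tᶜ = 0) (hν : ν Tᶜ = 0)
    {γ : @Measure (X × X) (borel (X × X))} (hγ : IsCoupling γ μ ν) (p : ℝ) :
    ∃ π : Measure (T × T), IsProbabilityMeasure π ∧
      π.map (fun z => (z.1 : X)) = μ ∧ π.map (fun z => (z.2 : X)) = ν ∧
      cost p γ = ∫⁻ z, edist z.1 z.2 ^ p ∂π := by
  -- Both marginals live on `T`, so `γ` lives on the range of this closed embedding and is the image
  -- of its own pullback.
  have he : @MeasurableEmbedding (T × T) (X × X) _ (borel (X × X))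
      (fun z => ((z.1 : X), (z.2 : X))) := by
    have hc := hTc.isClosedEmbedding_subtypeVal.prodMap hTc.isClosedEmbedding_subtypeVal
    exact @Topology.IsClosedEmbedding.measurableEmbedding _ _ _ _ _ _ (borel _)
      (@BorelSpace.mk _ _ (borel _) rfl) _ hc
  have hfst := measurable_of_continuous_borel (continuous_fst (X := X) (Y := X))
  have hsnd := measurable_of_continuous_borel (continuous_snd (X := X) (Y := X))
  have hrange : γ (Set.range fun z : T × T => ((z.1 : X), (z.2 : X)))ᶜ = 0 := by
    refine measure_mono_null (t := Prod.fst ⁻¹' Tᶜ ∪ Prod.snd ⁻¹' Tᶜ) ?_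
      (measure_union_null ?_ ?_)
    · rintro ⟨x, y⟩ hxy
      by_contra hcon
      simp only [Set.mem_union, Set.mem_preimage, Set.mem_compl_iff, not_or, not_not] at hcon
      exact hxy ⟨(⟨x, hcon.1⟩, ⟨y, hcon.2⟩), rfl⟩
    · rw [← hγ.map_fst] at hμ
      rwa [@Measure.map_apply _ _ (borel _) _ _ _ hfst _ hTc.measurableSet.compl] at hμ
    · rw [← hγ.map_snd] at hν
      rwa [@Measure.map_apply _ _ (borel _) _ _ _ hsnd _ hTc.measurableSet.compl] at hν
  have hmap : @Measure.map _ _ _ (borel (X × X)) (fun z : T × T => ((z.1 : X), (z.2 : X)))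
      (@Measure.comap _ _ _ (borel (X × X)) (fun z : T × T => ((z.1 : X), (z.2 : X))) γ) = γ := by
    rw [@MeasurableEmbedding.map_comap _ _ _ (borel _) _ he γ]
    exact @Measure.restrict_eq_self_of_ae_mem _ (borel _) _ _ hrange
  have hm := map_pair (P := @Measure.comap _ _ _ (borel (X × X))
    (fun z : T × T => ((z.1 : X), (z.2 : X))) γ) (measurable_prodMap_coe T)
  rw [hmap] at hm
  refine ⟨_, ⟨?_⟩, hm.1.symm.trans hγ.map_fst, hm.2.symm.trans hγ.map_snd, ?_⟩
  · have := hγ.isProbabilityMeasure.measure_univ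
    rw [← hmap, @Measure.map_apply _ _ _ (borel _) _ _ (measurable_prodMap_coe T) _
      (@MeasurableSet.univ _ (borel _))] at this
    exact this
  · conv_lhs => rw [← hmap]
    exact cost_map p (measurable_prodMap_coe T)

theorem wassersteinDist_map_le {T : Set X} [SecondCountableTopology T] {Ω : Type*}
    [MeasurableSpace Ω] (P : Measure Ω) [IsProbabilityMeasure P] {f g : Ω → T}
    (hf : Measurable f) (hg : Measurable g) {p : ℝ} (hp : 0 ≤ p) :
    wassersteinDist p (P.map fun ω => (f ω : X)) (P.map fun ω => (g ω : X)) ≤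
      (∫⁻ ω, edist (f ω) (g ω) ^ p ∂P) ^ (1 / p) := by
  have hh : @Measurable Ω (X × X) _ (borel (X × X)) (fun ω => ((f ω : X), (g ω : X))) :=
    (measurable_prodMap_coe T).comp (hf.prodMk hg)
  refine (wassersteinDist_le hp (isCoupling_map (P := P) hh)).trans_eq ?_
  rw [cost_map p hh]
  rfl

end Separable

/-! ### Gluing by disintegration -/

section Gluing

open ProbabilityTheory

/-- Gluing of two probability measures along a common marginal. -/
theorem exists_gluing {A B C : Type*} [MeasurableSpace A] [StandardBorelSpace A] [Nonempty A]
    [MeasurableSpace B] [MeasurableSpace C] [StandardBorelSpace C] [Nonempty C]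
    (π : Measure (A × B)) (ρ : Measure (B × C)) [IsProbabilityMeasure π] [IsProbabilityMeasure ρ]
    (h : π.snd = ρ.fst) :
    ∃ P : Measure (B × A × C), IsProbabilityMeasure P ∧
      P.map (fun z => (z.2.1, z.1)) = π ∧ P.map (fun z => (z.1, z.2.2)) = ρ := by
  have : IsProbabilityMeasure (π.map Prod.swap) :=
    Measure.isProbabilityMeasure_map measurable_swap.aemeasurable
  have hfst : (π.map Prod.swap).fst = ρ.fst := by rw [Measure.fst_map_swap, h]
  -- Given the point of `B`, the points of `A` and `C` are drawn independently from the two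
  -- conditional laws.
  refine ⟨ρ.fst ⊗ₘ ((π.map Prod.swap).condKernel ×ₖ ρ.condKernel), inferInstance, ?_, ?_⟩
  · have h1 := Measure.compProd_map (μ := ρ.fst)
      (κ := (π.map Prod.swap).condKernel ×ₖ ρ.condKernel) measurable_fst
    rw [← Kernel.fst_eq, Kernel.fst_prod, ← hfst, (π.map Prod.swap).disintegrate] at h1
    have h2 := congrArg (Measure.map Prod.swap) h1
    rw [Measure.map_map measurable_swap measurable_swap, Measure.map_map measurable_swap
      (by fun_prop), hfst] at h2
    simp only [Prod.swap_swap_eq, Measure.map_id] at h2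
    exact h2.symm
  · have h1 := Measure.compProd_map (μ := ρ.fst)
      (κ := (π.map Prod.swap).condKernel ×ₖ ρ.condKernel) measurable_snd
    rw [← Kernel.snd_eq, Kernel.snd_prod, ρ.disintegrate] at h1
    exact h1.symm

end Gluing

/-! ### The triangle inequality -/

section Triangle

variable {X : Type*} [MetricSpace X] [CompleteSpace X] [MeasurableSpace X] [BorelSpace X]

/-- Nearly optimal couplings suffice: they are glued along the middle marginal, and Minkowski's
inequality bounds the cost between the two ends. -/
theorem wassersteinDist_triangle {p : ℝ} (hp : 1 ≤ p) (μ : Fin 3 → Measure X)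
    [∀ i, IsProbabilityMeasure (μ i)] (h : ∀ i, (μ i).InnerRegular) :
    wassersteinDist p (μ 0) (μ 2) ≤ wassersteinDist p (μ 0) (μ 1) + wassersteinDist p (μ 1) (μ 2) := by
  have hp0 : 0 < p := by linarith
  obtain ⟨T, hTc, hTs, hT⟩ := exists_isClosed_isSeparable μ h
  have := secondCountableTopology_of_isSeparable hTs
  have : CompleteSpace T := hTc.completeSpace_coe
  have : PolishSpace T := inferInstance
  have : Nonempty T := by
    by_contra hne
    have : T = ∅ := Set.not_nonempty_iff_eq_empty.1 fun h => hne h.to_subtype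
    have h1 := hT 0
    simp [this] at h1
  refine ENNReal.le_of_forall_pos_le_add fun ε hε hlt => ?_
  have hε' : (ε / 2 : ℝ≥0∞) ≠ 0 := by simp [hε.ne']
  obtain ⟨γ, hγ, hγc⟩ := exists_coupling_lt hp0
    (ENNReal.lt_add_right (ENNReal.add_lt_top.1 hlt).1.ne hε')
  obtain ⟨γ', hγ', hγc'⟩ := exists_coupling_lt hp0
    (ENNReal.lt_add_right (ENNReal.add_lt_top.1 hlt).2.ne hε')
  obtain ⟨π, hπ, hπ0, hπ1, hπc⟩ := hγ.exists_measure_subtype hTc (hT 0) (hT 1) p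
  obtain ⟨ρ, hρ, hρ1, hρ2, hρc⟩ := hγ'.exists_measure_subtype hTc (hT 1) (hT 2) p
  have hemb := MeasurableEmbedding.subtype_coe hTc.measurableSet
  have hglue : π.snd = ρ.fst := by
    have h1 : π.snd.map ((↑) : T → X) = ρ.fst.map (↑) := by
      rw [Measure.snd, Measure.fst, Measure.map_map measurable_subtype_coe measurable_snd,
        Measure.map_map measurable_subtype_coe measurable_fst]
      exact hπ1.trans hρ1.symm
    rw [← hemb.comap_map π.snd, ← hemb.comap_map ρ.fst, h1]
  obtain ⟨P, hP, hP1, hP2⟩ := exists_gluing π ρ hglue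
  -- The first coordinate of `T × T × T` is the middle point; the other two are the ends.
  have m0 : Measurable fun z : T × T × T => z.2.1 := by fun_prop
  have m1 : Measurable fun z : T × T × T => z.1 := by fun_prop
  have m2 : Measurable fun z : T × T × T => z.2.2 := by fun_prop
  have e0 : P.map (fun z => (z.2.1 : X)) = μ 0 := by
    rw [← hπ0, ← hP1, Measure.map_map (by fun_prop) (by fun_prop)]; rfl
  have e2 : P.map (fun z => (z.2.2 : X)) = μ 2 := by
    rw [← hρ2, ← hP2, Measure.map_map (by fun_prop) (by fun_prop)]; rfl
  have hmeas : Measurable fun z : T × T => edist z.1 z.2 ^ p := by fun_prop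
  have c1 : cost p γ = ∫⁻ z, edist z.2.1 z.1 ^ p ∂P := by
    rw [hπc, ← hP1, lintegral_map hmeas (by fun_prop)]
  have c2 : cost p γ' = ∫⁻ z, edist z.1 z.2.2 ^ p ∂P := by
    rw [hρc, ← hP2, lintegral_map hmeas (by fun_prop)]
  calc wassersteinDist p (μ 0) (μ 2)
      ≤ (∫⁻ z, edist z.2.1 z.2.2 ^ p ∂P) ^ (1 / p) := by
        rw [← e0, ← e2]
        exact wassersteinDist_map_le P m0 m2 hp0.le
    _ ≤ (∫⁻ z, (((fun z : T × T × T => edist z.2.1 z.1) +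
          fun z : T × T × T => edist z.1 z.2.2) z) ^ p ∂P)
          ^ (1 / p) := by
        refine ENNReal.rpow_le_rpow (lintegral_mono fun z => ?_) (by positivity)
        exact ENNReal.rpow_le_rpow (edist_triangle _ _ _) hp0.le
    _ ≤ cost p γ ^ (1 / p) + cost p γ' ^ (1 / p) := by
        rw [c1, c2]
        exact ENNReal.lintegral_Lp_add_le (m0.edist m1).aemeasurable (m1.edist m2).aemeasurable hp
    _ ≤ _ := by
        refine (add_le_add hγc.le hγc'.le).trans_eq ?_
        rw [add_add_add_comm, ENNReal.add_halves]

end Triangle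

open scoped NNReal

/-! ### Quantitative couplings and finiteness -/

section CostBounds

variable {X : Type*} [MetricSpace X] [MeasurableSpace X] [BorelSpace X]

/-- The constant `2 ^ (p - 1)` comes from convexity of `t ^ p`, applied to the triangle inequality
through `x₀`. -/
theorem lintegral_edist_rpow_le_moment {Ω : Type*} {mΩ : MeasurableSpace Ω} {P : Measure Ω}
    {f g : Ω → X} (hf : Measurable f) (hg : Measurable g) {p : ℝ} (hp : 1 ≤ p) (x₀ : X) :
    ∫⁻ ω, edist (f ω) (g ω) ^ p ∂P ≤
      2 ^ (p - 1) * (moment p x₀ (P.map f) + moment p x₀ (P.map g)) := by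
  have hp0 : 0 < p := by linarith
  have hm := measurable_edist_rpow p x₀
  rw [moment, moment, lintegral_map hm hf, lintegral_map hm hg,
    ← lintegral_add_left (f := fun ω => edist x₀ (f ω) ^ p) (hm.comp hf),
    ← lintegral_const_mul _ (by fun_prop)]
  refine lintegral_mono fun ω => ?_
  refine le_trans (ENNReal.rpow_le_rpow ?_ hp0.le) (ENNReal.rpow_add_le_mul_rpow_add_rpow _ _ hp)
  exact edist_triangle_left _ _ _

theorem lintegral_edist_rpow_le_of_measure_compl_eq_zero {Ω : Type*} {mΩ : MeasurableSpace Ω}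
    {P : Measure Ω} {f g : Ω → X} (hf : Measurable f) (hg : Measurable g) {p : ℝ} (hp : 0 ≤ p)
    {y : X} {ε : ℝ≥0∞} (hPf : P.map f {x | edist y x ≤ ε}ᶜ = 0)
    (hPg : P.map g {x | edist y x ≤ ε}ᶜ = 0) :
    ∫⁻ ω, edist (f ω) (g ω) ^ p ∂P ≤ (2 * ε) ^ p * P.map f Set.univ := by
  have hS : MeasurableSet {x | edist y x ≤ ε} :=
    measurableSet_le measurable_edist_right measurable_const
  rw [Measure.map_apply hf hS.compl] at hPf
  rw [Measure.map_apply hg hS.compl] at hPg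
  rw [Measure.map_apply hf .univ, Set.preimage_univ, ← lintegral_const]
  refine lintegral_mono_ae ?_
  have hPf' : ∀ᵐ ω ∂P, edist y (f ω) ≤ ε := hPf
  have hPg' : ∀ᵐ ω ∂P, edist y (g ω) ≤ ε := hPg
  filter_upwards [hPf', hPg'] with ω h1 h2
  refine ENNReal.rpow_le_rpow ((edist_triangle_left _ _ y).trans ?_) hp
  rw [two_mul]
  exact add_le_add h1 h2

omit [MetricSpace X] [BorelSpace X] in
theorem map_sum_add {Ω : Type*} {mΩ : MeasurableSpace Ω} {ι : Type*} (γ : ι → Measure Ω)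
    (γ' : Measure Ω) {f : Ω → X} (hf : Measurable f) :
    (Measure.sum γ + γ').map f = Measure.sum (fun i => (γ i).map f) + γ'.map f := by
  rw [Measure.map_add _ _ hf, Measure.map_sum hf.aemeasurable]

omit [MetricSpace X] [BorelSpace X] in
/-- A measure splits along a finite family of densities with prescribed masses. -/
theorem exists_sum_add_eq (μ : Measure X) {ι : Type*} [Fintype ι] {φ : ι → X → ℝ≥0∞}
    (hφ : ∀ i, Measurable (φ i)) (hsum : ∀ x, ∑ i, φ i x ≤ 1) {c : ι → ℝ≥0∞}
    (hc : ∀ i, c i ≤ ∫⁻ x, φ i x ∂μ) (hfin : ∀ i, ∫⁻ x, φ i x ∂μ ≠ ∞) :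
    ∃ (α : ι → Measure X) (ρ : Measure X), Measure.sum α + ρ = μ ∧
      (∀ i, α i Set.univ = c i) ∧ ∀ i (S : Set X), (∀ x, φ i x ≠ 0 → x ∈ S) → α i Sᶜ = 0 := by
  -- Each density is scaled down to mass exactly `c i`; if its integral vanishes, so does `c i`.
  set q : ι → ℝ≥0∞ := fun i => c i / ∫⁻ x, φ i x ∂μ
  have hq : ∀ i, q i ≤ 1 := fun i => ENNReal.div_le_of_le_mul (by simpa using hc i)
  have hm : ∀ i, Measurable fun x => q i * φ i x := fun i => (hφ i).const_mul _
  have hle : ∀ x, ∑ i, q i * φ i x ≤ 1 := fun x =>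
    (Finset.sum_le_sum fun i _ => mul_le_of_le_one_left zero_le (hq i)).trans (hsum x)
  refine ⟨fun i => μ.withDensity fun x => q i * φ i x,
    μ.withDensity fun x => 1 - ∑ i, q i * φ i x, ?_, fun i => ?_, fun i S hS => ?_⟩
  · rw [← withDensity_tsum hm, ← withDensity_add_right]
    · conv_rhs => rw [← withDensity_one (μ := μ)]
      congr 1
      funext x
      simp only [tsum_fintype, Pi.add_apply, Finset.sum_apply, Pi.one_apply]
      exact add_tsub_cancel_of_le (hle x)
    · exact measurable_const.sub (Finset.measurable_sum _ fun i _ => hm i)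
  · rw [withDensity_apply _ .univ, Measure.restrict_univ, lintegral_const_mul _ (hφ i)]
    rcases eq_or_ne (∫⁻ x, φ i x ∂μ) 0 with h0 | h0
    · have := hc i
      rw [h0] at this ⊢
      rw [le_antisymm this zero_le, mul_zero]
    · exact ENNReal.div_mul_cancel h0 (hfin i)
  · have h0 : μ.withDensity (fun x => q i * φ i x) {x | φ i x = 0} = 0 := by
      have hS : MeasurableSet {x | φ i x = 0} := hφ i (measurableSet_singleton 0)
      rw [withDensity_apply _ hS, setLIntegral_congr_fun (g := fun _ => 0) hS, lintegral_zero]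
      intro x hx
      have : φ i x = 0 := hx
      simp [this]
    refine measure_mono_null (fun x hx => ?_) h0
    by_contra hne
    exact hx (hS x hne)

/-- The basic quantitative coupling: transport within the pieces of a finite family of densities of
small support, and couple the remainders independently. -/
theorem exists_coupling_cost_le {p : ℝ} (hp : 1 ≤ p) (x₀ : X) {T : Set X} (hTm : MeasurableSet T)
    (hTs : TopologicalSpace.IsSeparable T) (μ ν : Measure X) [IsProbabilityMeasure μ]
    [IsProbabilityMeasure ν] (hμ : μ Tᶜ = 0) (hν : ν Tᶜ = 0)
    {ι : Type*} [Fintype ι] {φ : ι → X → ℝ≥0∞}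
    (hφ : ∀ i, Measurable (φ i)) (hsum : ∀ x, ∑ i, φ i x ≤ 1) {y : ι → X} {ε : ℝ≥0∞}
    (hsupp : ∀ i x, φ i x ≠ 0 → edist (y i) x ≤ ε) :
    ∃ (γ : @Measure (X × X) (borel (X × X))) (ρ σ : Measure X), IsCoupling γ μ ν ∧
      ρ ≤ μ ∧ σ ≤ ν ∧
      ρ Set.univ = 1 - ∑ i, min (∫⁻ x, φ i x ∂μ) (∫⁻ x, φ i x ∂ν) ∧
      σ Set.univ = 1 - ∑ i, min (∫⁻ x, φ i x ∂μ) (∫⁻ x, φ i x ∂ν) ∧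
      cost p γ ≤ (2 * ε) ^ p + 2 ^ (p - 1) * (moment p x₀ ρ + moment p x₀ σ) := by
  have hp0 : 0 < p := by linarith
  have hφ1 : ∀ i x, φ i x ≤ 1 := fun i x =>
    (Finset.single_le_sum (f := fun i => φ i x) (fun _ _ => zero_le) (Finset.mem_univ i)).trans
      (hsum x)
  have hint : ∀ (μ : Measure X) [IsProbabilityMeasure μ] i, ∫⁻ x, φ i x ∂μ ≠ ∞ := fun μ _ i =>
    ((lintegral_mono (hφ1 i)).trans_lt (by simp)).ne
  -- The mass that `μ` and `ν` share on piece `i`: the matched parts then have equal masses, and so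
  -- do the remainders.
  set c : ι → ℝ≥0∞ := fun i => min (∫⁻ x, φ i x ∂μ) (∫⁻ x, φ i x ∂ν)
  obtain ⟨α, ρ, hα, hαc, hαS⟩ := exists_sum_add_eq μ hφ hsum (c := c)
    (fun i => min_le_left _ _) (hint μ)
  obtain ⟨β, σ, hβ, hβc, hβS⟩ := exists_sum_add_eq ν hφ hsum (c := c)
    (fun i => min_le_right _ _) (hint ν)
  have hαμ : ∀ i, α i ≤ μ := fun i => by
    rw [← hα]; exact (Measure.le_sum α i).trans (Measure.le_add_right le_rfl)
  have hβν : ∀ i, β i ≤ ν := fun i => by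
    rw [← hβ]; exact (Measure.le_sum β i).trans (Measure.le_add_right le_rfl)
  have hρ : ρ ≤ μ := by rw [← hα]; exact Measure.le_add_left le_rfl
  have hσ : σ ≤ ν := by rw [← hβ]; exact Measure.le_add_left le_rfl
  have hαu := congrArg (fun m : Measure X => m Set.univ) hα
  have hβu := congrArg (fun m : Measure X => m Set.univ) hβ
  simp only [Measure.coe_add, Pi.add_apply, Measure.sum_apply _ MeasurableSet.univ, hαc, hβc,
    tsum_fintype, measure_univ] at hαu hβu
  have hc1 : ∑ i, c i ≤ 1 := hαu ▸ le_self_add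
  have hct : ∑ i, c i ≠ ∞ := (hc1.trans_lt ENNReal.one_lt_top).ne
  have hρu : ρ Set.univ = 1 - ∑ i, c i := ENNReal.eq_sub_of_add_eq' ENNReal.one_ne_top
    (by rw [add_comm]; exact hαu)
  have hσu : σ Set.univ = 1 - ∑ i, c i := ENNReal.eq_sub_of_add_eq' ENNReal.one_ne_top
    (by rw [add_comm]; exact hβu)
  have := fun i => isFiniteMeasure_of_le _ (hαμ i)
  have := fun i => isFiniteMeasure_of_le _ (hβν i)
  have := isFiniteMeasure_of_le _ hρ
  have := isFiniteMeasure_of_le _ hσ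
  choose γ hγα hγβ using fun i => exists_measure_map_fst_snd hTm hTs (α i) (β i)
    (le_antisymm ((hαμ i _).trans_eq hμ) zero_le) (le_antisymm ((hβν i _).trans_eq hν) zero_le)
    ((hαc i).trans (hβc i).symm)
  obtain ⟨γ', hγ'ρ, hγ'σ⟩ := exists_measure_map_fst_snd hTm hTs ρ σ
    (le_antisymm ((hρ _).trans_eq hμ) zero_le) (le_antisymm ((hσ _).trans_eq hν) zero_le)
    (hρu.trans hσu.symm)
  have hfst := measurable_of_continuous_borel (continuous_fst (X := X) (Y := X))
  have hsnd := measurable_of_continuous_borel (continuous_snd (X := X) (Y := X))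
  have h1 := map_sum_add γ γ' hfst
  have h2 := map_sum_add γ γ' hsnd
  simp only [hγα, hγβ, hγ'ρ, hγ'σ, hα, hβ] at h1 h2
  refine ⟨Measure.sum γ + γ', ρ, σ, ⟨⟨?_⟩, h1, h2⟩, hρ, hσ, hρu, hσu, ?_⟩
  · have h3 := measure_univ (μ := μ)
    rwa [← h1, @Measure.map_apply _ _ (borel _) _ _ _ hfst _ .univ, Set.preimage_univ] at h3
  · have hcost : cost p (Measure.sum γ + γ') = ∑ i, cost p (γ i) + cost p γ' := by
      rw [cost, lintegral_add_measure, lintegral_sum_measure, tsum_fintype]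
      rfl
    rw [hcost]
    refine add_le_add ?_ ?_
    · calc ∑ i, cost p (γ i) ≤ ∑ i, (2 * ε) ^ p * c i := by
            refine Finset.sum_le_sum fun i _ => ?_
            have := lintegral_edist_rpow_le_of_measure_compl_eq_zero (P := γ i) hfst hsnd hp0.le
              (y := y i) (ε := ε) (by rw [hγα]; exact hαS i _ (hsupp i))
              (by rw [hγβ]; exact hβS i _ (hsupp i))
            rwa [hγα, hαc] at this
        _ ≤ (2 * ε) ^ p := by
            rw [← Finset.mul_sum]
            exact mul_le_of_le_one_right zero_le hc1
    · have := lintegral_edist_rpow_le_moment (P := γ') hfst hsnd hp x₀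
      rwa [hγ'ρ, hγ'σ] at this

/-- The Wasserstein distance of Radon probability measures of finite moment is finite. -/
theorem wassersteinDist_ne_top {p : ℝ} (hp : 1 ≤ p) (x₀ : X) (μ : Fin 2 → Measure X)
    [∀ i, IsProbabilityMeasure (μ i)] (h : ∀ i, (μ i).InnerRegular)
    (hfin : ∀ i, moment p x₀ (μ i) ≠ ∞) : wassersteinDist p (μ 0) (μ 1) ≠ ∞ := by
  have hp0 : 0 < p := by linarith
  obtain ⟨T, hTc, hTs, hT⟩ := exists_isClosed_isSeparable μ h
  -- With no pieces everything is remainder, and the moments alone bound the cost.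
  obtain ⟨γ, ρ, σ, hγ, hρ, hσ, -, -, hcost⟩ := exists_coupling_cost_le hp x₀ hTc.measurableSet hTs
    (μ 0) (μ 1) (hT 0) (hT 1) (ι := Empty) (φ := fun _ _ => 0) (by simp) (by simp) (y := fun _ => x₀)
    (ε := 0) (by simp)
  refine ne_top_of_le_ne_top ?_ (wassersteinDist_le hp0.le hγ)
  refine ENNReal.rpow_ne_top_of_nonneg (by positivity) (ne_top_of_le_ne_top ?_ hcost)
  have h1 : moment p x₀ ρ ≤ moment p x₀ (μ 0) := lintegral_mono' hρ le_rfl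
  have h2 : moment p x₀ σ ≤ moment p x₀ (μ 1) := lintegral_mono' hσ le_rfl
  refine ENNReal.add_ne_top.2 ⟨by simp [hp0], ENNReal.mul_ne_top (by simp) ?_⟩
  exact ENNReal.add_ne_top.2 ⟨ne_top_of_le_ne_top (hfin 0) h1, ne_top_of_le_ne_top (hfin 1) h2⟩

theorem moment_ne_top_of_moment_ne_top {p : ℝ} (hp : 1 ≤ p) {x₀ : X} (x₁ : X) {μ : Measure X}
    [IsFiniteMeasure μ] (h : moment p x₀ μ ≠ ∞) : moment p x₁ μ ≠ ∞ := by
  have hp0 : 0 < p := by linarith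
  -- The moment about `x₁` is the cost of moving `μ` to the point `x₁`.
  have h1 := lintegral_edist_rpow_le_moment (P := μ) (f := fun _ => x₁) (g := id)
    measurable_const measurable_id hp x₀
  refine ne_top_of_le_ne_top (ENNReal.mul_ne_top (by simp) (ENNReal.add_ne_top.2 ⟨?_, ?_⟩)) h1
  · rw [moment, lintegral_map (measurable_edist_rpow p x₀) measurable_const, lintegral_const]
    exact ENNReal.mul_ne_top (by simp [hp0.le, edist_ne_top]) (measure_ne_top _ _)
  · simpa using h

end CostBounds

/-! ### From `p`-weak convergence to `W_p` convergence -/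

section Convergence

variable {X : Type*} [MetricSpace X] [MeasurableSpace X] [BorelSpace X]

omit [BorelSpace X] in
-- The part of `d ^ p` below `C` sees only the small mass of `ρ`; the excess is bounded by a tail of
-- `μ`, whatever `ρ` is.
theorem moment_le_mul_add {p : ℝ} (x₀ : X) {ρ μ : Measure X} (h : ρ ≤ μ) (C : ℝ≥0∞) :
    moment p x₀ ρ ≤ C * ρ Set.univ + ∫⁻ x, (edist x₀ x ^ p - C) ∂μ := by
  rw [← lintegral_const]
  refine le_trans ?_ (add_le_add_right (lintegral_mono' h le_rfl) _)
  rw [← lintegral_add_left measurable_const]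
  exact lintegral_mono fun x => le_add_tsub

/-- This expresses the tail through the moment and the integral of a bounded function, the two
quantities that `p`-weak convergence controls. -/
theorem lintegral_tsub_eq {p : ℝ} (x₀ : X) (μ : Measure X) [IsFiniteMeasure μ] (C : ℝ≥0) :
    ∫⁻ x, (edist x₀ x ^ p - C) ∂μ = moment p x₀ μ - ∫⁻ x, min (edist x₀ x ^ p) C ∂μ := by
  have hm := measurable_edist_rpow p x₀
  have hfin : ∫⁻ x, min (edist x₀ x ^ p) C ∂μ ≠ ∞ := by
    refine ne_top_of_le_ne_top ?_ (lintegral_mono fun x => min_le_right _ _)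
    rw [lintegral_const]
    exact ENNReal.mul_ne_top ENNReal.coe_ne_top (measure_ne_top _ _)
  refine ENNReal.eq_sub_of_add_eq hfin ?_
  rw [← lintegral_add_left (f := fun x => edist x₀ x ^ p - C) (hm.sub measurable_const), moment]
  refine lintegral_congr fun x => ?_
  rcases le_total (edist x₀ x ^ p) C with h | h
  · rw [min_eq_left h, tsub_eq_zero_of_le h, zero_add]
  · rw [min_eq_right h, tsub_add_cancel_of_le h]

theorem tendsto_lintegral_tsub {p : ℝ} (hp : 0 ≤ p) (x₀ : X) {μ : Measure X}
    (h : moment p x₀ μ ≠ ∞) :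
    Tendsto (fun n : ℕ => ∫⁻ x, (edist x₀ x ^ p - n) ∂μ) atTop (𝓝 0) := by
  have hm := measurable_edist_rpow p x₀
  have := tendsto_lintegral_of_dominated_convergence (μ := μ)
    (F := fun (n : ℕ) x => edist x₀ x ^ p - n) (f := fun _ => 0) (fun x => edist x₀ x ^ p)
    (fun n => hm.sub measurable_const) (fun n => .of_forall fun x => tsub_le_self) h
    (.of_forall fun x => ?_)
  · simpa using this
  · obtain ⟨N, hN⟩ := ENNReal.exists_nat_gt
      (ENNReal.rpow_ne_top_of_nonneg hp (edist_ne_top x₀ x))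
    refine tendsto_const_nhds.congr' ?_
    filter_upwards [eventually_ge_atTop N] with n hn
    exact (tsub_eq_zero_of_le (hN.le.trans (by exact_mod_cast hn))).symm

theorem tendsto_lintegral_of_continuous {ι : Type*} {l : Filter ι} {μs : ι → ProbabilityMeasure X}
    {μ : ProbabilityMeasure X} (h : Tendsto μs l (𝓝 μ)) {f : X → ℝ≥0} (hf : Continuous f) (C : ℝ≥0)
    (hC : ∀ x, f x ≤ C) :
    Tendsto (fun i => ∫⁻ x, f x ∂(μs i : Measure X)) l (𝓝 (∫⁻ x, f x ∂(μ : Measure X))) := by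
  refine ProbabilityMeasure.tendsto_iff_forall_lintegral_tendsto.1 h
    (BoundedContinuousFunction.mkOfBound ⟨f, hf⟩ C fun x y => ?_)
  have h1 : (f x : ℝ) ≤ C := hC x
  have h2 : (f y : ℝ) ≤ C := hC y
  rw [ContinuousMap.coe_mk, NNReal.dist_eq, abs_sub_le_iff]
  constructor <;> linarith [(f x).coe_nonneg, (f y).coe_nonneg]

theorem tendsto_lintegral_tsub_of_tendsto {p : ℝ} (hp : 0 ≤ p) (x₀ : X) {ι : Type*} {l : Filter ι}
    {μs : ι → ProbabilityMeasure X} {μ : ProbabilityMeasure X} (h : Tendsto μs l (𝓝 μ))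
    (hmom : Tendsto (fun i => moment p x₀ (μs i : Measure X)) l (𝓝 (moment p x₀ (μ : Measure X))))
    (hfin : moment p x₀ (μ : Measure X) ≠ ∞) (C : ℝ≥0) :
    Tendsto (fun i => ∫⁻ x, (edist x₀ x ^ p - C) ∂(μs i : Measure X)) l
      (𝓝 (∫⁻ x, (edist x₀ x ^ p - C) ∂(μ : Measure X))) := by
  simp only [lintegral_tsub_eq]
  refine ENNReal.Tendsto.sub hmom ?_ (Or.inl hfin)
  have := tendsto_lintegral_of_continuous h (f := fun x => min (nndist x₀ x ^ p) C)
    (((NNReal.continuous_rpow_const hp).comp (by fun_prop)).min continuous_const) C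
    (fun x => min_le_right _ _)
  simpa only [ENNReal.coe_min, ENNReal.coe_rpow_of_nonneg _ hp, ← edist_nndist] using this

/-- A finite family of continuous functions of small support that sums to one up to a set of small
measure. -/
theorem exists_continuous_partition (μ : Measure X) [IsProbabilityMeasure μ] (h : μ.InnerRegular)
    {ε : ℝ} (hε : 0 < ε) {η : ℝ≥0∞} (hη : η ≠ 0) :
    ∃ (s : Finset X) (φ : s → X → ℝ≥0), (∀ i, Continuous (φ i)) ∧ (∀ x, ∑ i, φ i x ≤ 1) ∧
      (∀ i x, φ i x ≠ 0 → edist (i : X) x ≤ ENNReal.ofReal ε) ∧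
      1 ≤ ∑ i, ∫⁻ x, φ i x ∂μ + η := by
  have : 1 - η < μ Set.univ := by
    rw [measure_univ]
    exact ENNReal.sub_lt_self ENNReal.one_ne_top one_ne_zero hη
  obtain ⟨K, -, hK, hlt⟩ := MeasurableSet.univ.exists_lt_isCompact this
  obtain ⟨s, -, hs⟩ := hK.elim_nhds_subcover (fun x => Metric.ball x ε)
    (fun x _ => Metric.ball_mem_nhds x hε)
  obtain ⟨f, hf⟩ := PartitionOfUnity.exists_isSubordinate hK.isClosed
    (fun i : s => Metric.ball (i : X) ε) (fun i => Metric.isOpen_ball)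
    (by simpa [Set.iUnion_subtype] using hs)
  have hsum : ∀ x, ((∑ i, (f i x).toNNReal : ℝ≥0) : ℝ) = ∑ᶠ i, f i x := by
    intro x
    rw [finsum_eq_sum_of_fintype, NNReal.coe_sum]
    exact Finset.sum_congr rfl fun i _ => Real.coe_toNNReal _ (f.nonneg i x)
  have hcont : ∀ i, Continuous fun x => (f i x).toNNReal := fun i =>
    continuous_real_toNNReal.comp (f i).continuous
  refine ⟨s, fun i x => (f i x).toNNReal, hcont, fun x => ?_, fun i x hx => ?_, ?_⟩
  · rw [← NNReal.coe_le_coe, hsum]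
    exact f.sum_le_one x
  · have hne : f i x ≠ 0 := fun h0 => hx (by simp [h0])
    have hmem := hf i (subset_tsupport _ hne)
    rw [Metric.mem_ball, dist_comm] at hmem
    rw [edist_dist]
    exact ENNReal.ofReal_le_ofReal hmem.le
  · rw [← lintegral_finsetSum _ fun i _ => (hcont i).measurable.coe_nnreal_ennreal]
    -- The functions sum to 1 on `K`, so their sum dominates the indicator of `K`, whose integral
    -- exceeds `1 - η`.
    refine tsub_le_iff_right.1 (hlt.le.trans ?_)
    rw [← lintegral_indicator_one hK.measurableSet]
    refine lintegral_mono fun x => ?_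
    by_cases hx : x ∈ K
    · have h1 : (∑ i, (f i x).toNNReal : ℝ≥0) = 1 := by
        rw [← NNReal.coe_inj, hsum, f.sum_eq_one hx, NNReal.coe_one]
      simp only [Set.indicator_of_mem hx, Pi.one_apply]
      rw [← ENNReal.ofNNReal_finsetSum, h1, ENNReal.coe_one]
    · simp [hx]

/-- Weak convergence together with convergence of moments implies convergence in the Wasserstein
distance. -/
theorem tendsto_wassersteinDist {p : ℝ} (hp : 1 ≤ p) (x₀ : X) {μs : ℕ → ProbabilityMeasure X}
    {μ : ProbabilityMeasure X} (hμs : ∀ i, (μs i : Measure X).InnerRegular)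
    (hμ : (μ : Measure X).InnerRegular) (h : Tendsto μs atTop (𝓝 μ))
    (hmom : Tendsto (fun i => moment p x₀ (μs i : Measure X)) atTop
      (𝓝 (moment p x₀ (μ : Measure X))))
    (hfin : moment p x₀ (μ : Measure X) ≠ ∞) :
    Tendsto (fun i => wassersteinDist p (μs i : Measure X) (μ : Measure X)) atTop (𝓝 0) := by
  have hp0 : 0 < p := by linarith
  -- The index `none` stands for the limit, so one `T` serves it and the whole sequence.
  obtain ⟨T, hTc, hTs, hT⟩ := exists_isClosed_isSeparable
    (fun i : Option ℕ => ((i.elim μ μs : ProbabilityMeasure X) : Measure X))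
    (by rintro (_ | i); exacts [hμ, hμs i])
  rw [ENNReal.tendsto_nhds_zero]
  intro c hc
  set δ : ℝ≥0∞ := c ^ p
  have hδ : 0 < δ := ENNReal.rpow_pos_of_nonneg hc hp0.le
  set A : ℝ≥0∞ := 2 ^ (p - 1)
  have hA : A ≠ ∞ := by simp [A]
  set tail : ℕ → Measure X → ℝ≥0∞ := fun n μ => ∫⁻ x, (edist x₀ x ^ p - n) ∂μ
  obtain ⟨n, hn⟩ : ∃ n, A * (tail n μ + tail n μ) < δ := by
    have ht := tendsto_lintegral_tsub hp0.le x₀ hfin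
    have ht' := ENNReal.Tendsto.const_mul (a := A) (ht.add ht) (Or.inr hA)
    rw [add_zero, mul_zero] at ht'
    exact (ht'.eventually_lt_const hδ).exists
  -- With the truncation level `n` fixed, `r` bounds both the radius of the pieces and the mass of
  -- `μ` that they miss.
  obtain ⟨r, hr0, hr⟩ : ∃ r : ℝ, 0 < r ∧ (2 * ENNReal.ofReal r) ^ p +
      A * ((n * ENNReal.ofReal r + tail n μ) + (n * ENNReal.ofReal r + tail n μ)) < δ := by
    have h0 : Tendsto (fun r : ℝ => ENNReal.ofReal r) (𝓝[>] 0) (𝓝 0) := by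
      simpa using (ENNReal.continuous_ofReal.tendsto 0).mono_left nhdsWithin_le_nhds
    have h1 : Tendsto (fun r : ℝ => (2 * ENNReal.ofReal r) ^ p) (𝓝[>] 0) (𝓝 0) := by
      have := ((ENNReal.continuous_rpow_const (y := p)).tendsto _).comp
        (ENNReal.Tendsto.const_mul (a := 2) h0 (Or.inr (by simp)))
      simpa [hp0, Function.comp_def] using this
    have h2 : Tendsto (fun r : ℝ => n * ENNReal.ofReal r + tail n μ) (𝓝[>] 0)
        (𝓝 (tail n μ)) := by
      simpa using (ENNReal.Tendsto.const_mul (a := (n : ℝ≥0∞)) h0 (Or.inr (by simp))).add_const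
        (tail n μ)
    have h3 := h1.add (ENNReal.Tendsto.const_mul (a := A) (h2.add h2) (Or.inr hA))
    rw [zero_add] at h3
    obtain ⟨r, hlt, hpos⟩ := ((h3.eventually_lt_const hn).and self_mem_nhdsWithin).exists
    exact ⟨r, hpos, hlt⟩
  obtain ⟨s, φ, hφc, hφ1, hφs, hφμ⟩ := exists_continuous_partition (μ : Measure X) hμ hr0
    (ENNReal.ofReal_pos.2 hr0).ne'
  have hφle : ∀ i x, φ i x ≤ 1 := fun i x =>
    (Finset.single_le_sum (f := fun i => φ i x) (fun _ _ => zero_le) (Finset.mem_univ i)).trans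
      (hφ1 x)
  -- The unmatched mass at index `k`. By weak convergence each minimum tends to the integral against
  -- `μ`, so the limit is the mass missed by the partition, at most `r`.
  set m : ℕ → ℝ≥0∞ := fun k =>
    1 - ∑ i, min (∫⁻ x, φ i x ∂(μs k : Measure X)) (∫⁻ x, φ i x ∂(μ : Measure X))
  have hm : Tendsto m atTop (𝓝 (1 - ∑ i, ∫⁻ x, φ i x ∂(μ : Measure X))) := by
    refine ENNReal.Tendsto.sub tendsto_const_nhds (tendsto_finsetSum _ fun i _ => ?_)
      (Or.inl ENNReal.one_ne_top)
    simpa using (tendsto_lintegral_of_continuous h (hφc i) 1 (hφle i)).min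
      (tendsto_const_nhds (x := ∫⁻ x, φ i x ∂(μ : Measure X)))
  have hm_le : 1 - ∑ i, ∫⁻ x, φ i x ∂(μ : Measure X) ≤ ENNReal.ofReal r := by
    rwa [tsub_le_iff_left]
  have htail : Tendsto (fun k => tail n (μs k)) atTop (𝓝 (tail n μ)) := by
    simpa using tendsto_lintegral_tsub_of_tendsto hp0.le x₀ h hmom hfin n
  have hnm := ENNReal.Tendsto.const_mul (a := (n : ℝ≥0∞)) hm (Or.inr (by simp))
  have hlim := (ENNReal.Tendsto.const_mul (a := A)
    ((hnm.add htail).add (hnm.add_const (tail n μ))) (Or.inr hA)).const_add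
      ((2 * ENNReal.ofReal r) ^ p)
  have hlt : (2 * ENNReal.ofReal r) ^ p +
      A * ((n * (1 - ∑ i, ∫⁻ x, φ i x ∂(μ : Measure X)) + tail n μ) +
        (n * (1 - ∑ i, ∫⁻ x, φ i x ∂(μ : Measure X)) + tail n μ)) < δ := by
    refine lt_of_le_of_lt ?_ hr
    gcongr
  filter_upwards [hlim.eventually_lt_const hlt] with k hk
  obtain ⟨γ, ρ, σ, hγ, hρ, hσ, hρu, hσu, hcost⟩ := exists_coupling_cost_le hp x₀ hTc.measurableSet
    hTs (μs k : Measure X) (μ : Measure X) (hT (some k)) (hT none) (φ := fun i x => (φ i x : ℝ≥0∞))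
    (fun i => (hφc i).measurable.coe_nnreal_ennreal) (fun x => by exact_mod_cast hφ1 x)
    (y := fun i => (i : X)) (ε := ENNReal.ofReal r)
    (fun i x hx => hφs i x (by simpa using hx))
  have h1 := moment_le_mul_add (p := p) x₀ hρ n
  have h2 := moment_le_mul_add (p := p) x₀ hσ n
  rw [hρu] at h1
  rw [hσu] at h2
  refine (wassersteinDist_le hp0.le hγ).trans ?_
  rw [one_div, ENNReal.rpow_inv_le_iff hp0]
  refine (hcost.trans ?_).trans hk.le
  gcongr

end Convergence

end Wasserstein

/-! ### The metric on `P_p(X)` and its convergence -/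

open Wasserstein in
theorem mainTheorem5 {X : Type*} [MetricSpace X] [CompleteSpace X] [MeasurableSpace X]
    [BorelSpace X] (p : ℝ) (hp : 1 ≤ p) :
    ∃ _ : MetricSpace (Wasserstein.PSpace p X),
      (∀ μ ν : Wasserstein.PSpace p X, edist μ ν =
        Wasserstein.wassersteinDist p (μ.toProb : Measure X) (ν.toProb : Measure X)) ∧
      ∀ (x₀ : X) (μs : ℕ → Wasserstein.PSpace p X) (μ : Wasserstein.PSpace p X),
        Tendsto μs atTop (𝓝 μ) ↔ Wasserstein.PWeakTendsto x₀ μs μ := by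
  have hp0 : 0 < p := by linarith
  have hmom : ∀ (x₀ : X) (μ : PSpace p X), moment p x₀ (μ.toProb : Measure X) ≠ ∞ := fun x₀ μ =>
    let ⟨_, hx₁⟩ := μ.finite_moment
    moment_ne_top_of_moment_ne_top hp x₀ hx₁.ne
  let E : EMetricSpace (PSpace p X) :=
    { edist := fun μ ν => wassersteinDist p (μ.toProb : Measure X) (ν.toProb : Measure X)
      edist_self := fun μ => wassersteinDist_self hp0 _
      edist_comm := fun μ ν => wassersteinDist_comm hp0 _ _
      edist_triangle := fun μ ν ξ => wassersteinDist_triangle hp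
        (fun i => ((![μ, ν, ξ] i).toProb : Measure X)) (fun i => (![μ, ν, ξ] i).radon)
      eq_of_edist_eq_zero := fun {μ ν} h => PSpace.ext (eq_of_wassersteinDist_eq_zero hp0 h) }
  have hne : ∀ μ ν : PSpace p X, edist μ ν ≠ ∞ := fun μ ν =>
    let ⟨x₀, _⟩ := μ.finite_moment
    wassersteinDist_ne_top hp x₀ (fun i => ((![μ, ν] i).toProb : Measure X))
      (fun i => (![μ, ν] i).radon) (fun i => hmom x₀ _)
  -- Passing to real-valued distances keeps `edist` definitionally, hence the `rfl`.
  refine ⟨EMetricSpace.toMetricSpace hne, fun μ ν => rfl, fun x₀ μs μ => ?_⟩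
  have key : Tendsto μs atTop (𝓝 μ) ↔ Tendsto (fun i => wassersteinDist p
      ((μs i).toProb : Measure X) (μ.toProb : Measure X)) atTop (𝓝 0) :=
    tendsto_iff_edist_tendsto_0
  refine Iff.trans key ⟨fun h => ⟨tendsto_of_wassersteinDist hp0 h, tendsto_moment hp x₀ h⟩,
    fun h => ?_⟩
  exact tendsto_wassersteinDist hp x₀ (fun i => (μs i).radon) μ.radon h.1 h.2 (hmom x₀ μ)
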